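/- For $m,n\in\mathbb N$ let $\mathbb S_m$ be the symmetric group on $[m]$, and let $P(x)_{ij}=\mathbf 1_{x(i)=j}$ ($x\in\mathbb S_m$) be its permutation matrices. Let $\rho^1:\mathbb S_m\to\mathbb R^{(m-1)\times(m-1)}$ be the $(m-1)$-dimensional irreducible constituent of $P$, written in a basis in which it is real and orthogonal, i.e. there is an orthogonal $m\times m$ matrix $U$ with $P(x)=U\,(1\oplus\rho^1(x))\,U^t$ for all $x\in\mathbb S_m$. Expectations are over a uniformly random $x\in\mathbb S_m^n$, and for $f:\mathbb S_m^n\to\mathbb R^{(m-1)\times(m-1)}$ put $\|f\|_2^2=\mathbb E_x\sum_{k,l}f(x)_{kl}^2$. Let $Lin(\mathbb S_m^n)$ be the space of functions of the form $x\mapsto\sum_{i=1}^n A^i\rho^1(x_i)$ with $A^1,\dots,A^n\in\mathbb R^{(m-1)\times(m-1)}$. **Theorem.** There is an absolute constant $C>0$ such that the following holds for all $m$, $n$, all such $\rho^1$ and all real $\tau$. Let $g:\mathbb S_m^n\to\mathbb R^{(m-1)\times(m-1)}$ be a function such that - $\mathbb E\,g=0$; - there exists a matrix $M$ such that $\mathrm{tr}(M)=1$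 and $g(x)g(x)^t=M$ for all $x\in\mathbb S_m^n$; - $\|g-Lin(\mathbb S_m^n)\|_2^2=\inf_{h\in Lin(\mathbb S_m^n)}\|g-h\|_2^2\le\tau$. Let $\sum_{i} A^i\rho^1(x_i)$ be the orthogonal projection of $g$ on $Lin(\mathbb S_m^n)$, that is, the element of $Lin(\mathbb S_m^n)$ closest to $g$ in $\|\cdot\|_2$. Then there exists $i\in[n]$ such that $$\mathbb E_x\sum_{k,l}\bigl(g(x)-A^i\rho^1(x_i)\bigr)_{kl}^2\le C\,m^5\,\tau .$$ -/

import Mathlib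

open scoped BigOperators Matrix

namespace SymmFKN

noncomputable section

/-- `ρ` is the `(m-1)`-dimensional irreducible constituent of the permutation representation
`P(x) i j = 1` if `x i = j` and `0` otherwise (this is `Equiv.Perm.permMatrix`), written in a basis in
which it is real and orthogonal: there is an orthogonal matrix `U` (`m` rows and `1 + (m-1)` columns)
with `P(x) = U (1 ⊕ ρ(x)) Uᵀ` for all `x`. -/
def IsStandardRep {m : ℕ}
    (ρ : Equiv.Perm (Fin m) → Matrix (Fin (m - 1)) (Fin (m - 1)) ℝ) : Prop :=
  ∃ U : Matrix (Fin m) (Unit ⊕ Fin (m - 1)) ℝ,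
    U * Uᵀ = 1 ∧ Uᵀ * U = 1 ∧
    ∀ x : Equiv.Perm (Fin m), x.permMatrix ℝ =
      U * (Matrix.fromBlocks 1 0 0 (ρ x) : Matrix (Unit ⊕ Fin (m - 1)) (Unit ⊕ Fin (m - 1)) ℝ) * Uᵀ

/-- `‖f‖₂² = 𝔼ₓ ‖f(x)‖²` for a matrix-valued function on `S_m^n`: the expectation is over a uniformly
random `x`, and the norm of a matrix is the Frobenius norm. -/
def sqNorm {m n d : ℕ} (f : (Fin n → Equiv.Perm (Fin m)) → Matrix (Fin d) (Fin d) ℝ) : ℝ :=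
  𝔼 x, ∑ k, ∑ l, (f x k l) ^ 2

/-- The function `x ↦ ∑ᵢ Aⁱ ρ(xᵢ)` on `S_m^n`. -/
def linFun {m n d : ℕ} (ρ : Equiv.Perm (Fin m) → Matrix (Fin d) (Fin d) ℝ)
    (A : Fin n → Matrix (Fin d) (Fin d) ℝ) :
    (Fin n → Equiv.Perm (Fin m)) → Matrix (Fin d) (Fin d) ℝ :=
  fun x => ∑ i, A i * ρ (x i)

/-- `Lin(S_m^n)`, the space of all functions `x ↦ ∑ᵢ Aⁱ ρ(xᵢ)`. -/
def Lin {m d : ℕ} (n : ℕ) (ρ : Equiv.Perm (Fin m) → Matrix (Fin d) (Fin d) ℝ) :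
    Set ((Fin n → Equiv.Perm (Fin m)) → Matrix (Fin d) (Fin d) ℝ) :=
  Set.range (linFun ρ)

/-- `‖g - S‖₂²`, the squared `L²` distance of `g` from a set `S` of functions. -/
def sqDist {m n d : ℕ} (g : (Fin n → Equiv.Perm (Fin m)) → Matrix (Fin d) (Fin d) ℝ)
    (S : Set ((Fin n → Equiv.Perm (Fin m)) → Matrix (Fin d) (Fin d) ℝ)) : ℝ :=
  ⨅ h : S, sqNorm (g - h.1)

end

end SymmFKN

open SymmFKN

open Function Finset

/-! ### Averages over finite product spaces and moment inequalities. -/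

section Expectation

/-! Let h = ∑ Aⁱρ(xᵢ) be the projection of g, t = ‖g - h‖², aᵢ = |Aⁱ|² and d = m - 1. Since tr M =
1, |g| = 1 pointwise; by orthogonality of the entries of ρ, ∑ aᵢ = 1 - t, and g is at squared
distance exactly 1 - aᵢ from Aⁱρ(xᵢ). So it suffices that one aᵢ is close to 1.

Put Q = h hᵀ - ∑ Aⁱ(Aⁱ)ᵀ. Because ρρᵀ = 1, only products of distinct variables survive in Q, and Q
has mean zero. As g gᵀ is constant, h hᵀ is nearly so, and for t ≤ 1 this gives E|Q| ≤ 6√t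
(`expect_sqrt_frobSq_quadPart_le`). Q has degree two, so a Bonami-type fourth moment bound upgrades
this to E|Q|² = O(d⁴t) (`expect_frobSq_quadPart_le`). On the other hand d·E|Q|² ≥ (∑ aᵢ)² - ∑ aᵢ²
(`le_expect_frobSq_quadPart`). Thus the off-diagonal mass of the aᵢ is O(m⁵t), which forces one of
them to dominate (`exists_one_sub_le`). -/

theorem expect_expect_update {ι G : Type*} [Fintype ι] [DecidableEq ι] [Fintype G] [Nonempty G]
    (i : ι) (F : (ι → G) → ℝ) : 𝔼 x, 𝔼 y, F (update x i y) = 𝔼 x, F x := by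
  classical
  have hinv : Involutive (fun p : (ι → G) × G => (update p.1 i p.2, p.1 i)) := by
    rintro ⟨x, y⟩
    simp
  calc 𝔼 x, 𝔼 y, F (update x i y) = 𝔼 p : (ι → G) × G, F (update p.1 i p.2) := by
        rw [← univ_product_univ, expect_product]
    _ = 𝔼 p : (ι → G) × G, F p.1 :=
        Fintype.expect_equiv hinv.toPerm _ _ fun p => rfl
    _ = 𝔼 x, F x := by
        rw [← univ_product_univ, expect_product]
        exact expect_congr rfl fun x _ => Fintype.expect_const (F x)

variable {Ω : Type*} [Fintype Ω]

theorem expect_nonneg_of_nonneg {u : Ω → ℝ} (hu : ∀ x, 0 ≤ u x) : 0 ≤ 𝔼 x, u x :=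
  expect_nonneg fun x _ => hu x

theorem expect_mul_le {u v : Ω → ℝ} {p q : ℝ} (hp : 0 ≤ p) (hq : 0 ≤ q)
    (hu : 𝔼 x, u x ^ 2 ≤ p ^ 2) (hv : 𝔼 x, v x ^ 2 ≤ q ^ 2) : 𝔼 x, u x * v x ≤ p * q := by
  refine abs_le_of_sq_le_sq' ?_ (by positivity) |>.2
  rw [mul_pow]
  exact (expect_mul_sq_le_sq_mul_sq univ u v).trans
    (mul_le_mul hu hv (expect_nonneg_of_nonneg fun _ => by positivity) (by positivity))

/-- If each `u a` has fourth moment controlled by its second moment, so does the `ℓ²` norm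
of the whole family. -/
theorem expect_sum_sq_sq_le {α : Type*} (s : Finset α) (u : α → Ω → ℝ) {κ : ℝ} (hκ : 0 ≤ κ)
    (hu : ∀ a, 𝔼 x, u a x ^ 4 ≤ (κ * 𝔼 x, u a x ^ 2) ^ 2) :
    𝔼 x, (∑ a ∈ s, u a x ^ 2) ^ 2 ≤ (κ * ∑ a ∈ s, 𝔼 x, u a x ^ 2) ^ 2 := by
  have h0 : ∀ a, 0 ≤ κ * 𝔼 x, u a x ^ 2 := fun a =>
    mul_nonneg hκ (expect_nonneg_of_nonneg fun _ => by positivity)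
  have hu' : ∀ a, 𝔼 x, (u a x ^ 2) ^ 2 ≤ (κ * 𝔼 x, u a x ^ 2) ^ 2 := fun a => by
    simpa only [← pow_mul] using hu a
  calc 𝔼 x, (∑ a ∈ s, u a x ^ 2) ^ 2
      = ∑ a ∈ s, ∑ b ∈ s, 𝔼 x, u a x ^ 2 * u b x ^ 2 := by
        simp only [sq (∑ a ∈ s, _), sum_mul_sum, expect_sum_comm]
    _ ≤ ∑ a ∈ s, ∑ b ∈ s, (κ * 𝔼 x, u a x ^ 2) * (κ * 𝔼 x, u b x ^ 2) :=
        sum_le_sum fun a _ => sum_le_sum fun b _ => expect_mul_le (h0 a) (h0 b) (hu' a) (hu' b)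
    _ = _ := by rw [← sum_mul_sum, ← mul_sum, sq]

/-- A nonnegative function whose fourth moment is controlled by its second moment has its second
moment controlled by its mean. -/
theorem expect_sq_le_of_fourth_moment {Z : Ω → ℝ} (hZ : ∀ x, 0 ≤ Z x) {κ : ℝ}
    (h : 𝔼 x, Z x ^ 4 ≤ (κ * 𝔼 x, Z x ^ 2) ^ 2) : 𝔼 x, Z x ^ 2 ≤ (κ * 𝔼 x, Z x) ^ 2 := by
  set e1 := 𝔼 x, Z x
  set e2 := 𝔼 x, Z x ^ 2
  set e3 := 𝔼 x, Z x ^ 3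
  set e4 := 𝔼 x, Z x ^ 4
  have p1 : 0 ≤ e1 := expect_nonneg_of_nonneg hZ
  have p2 : 0 ≤ e2 := expect_nonneg_of_nonneg fun _ => by positivity
  have p3 : 0 ≤ e3 := expect_nonneg_of_nonneg fun x => pow_nonneg (hZ x) 3
  -- Log-convexity of moments, by Cauchy–Schwarz; eliminating the third moment between `h13` and
  -- `h24` leaves the claim.
  have h13 : e2 ^ 2 ≤ e1 * e3 := by
    have := expect_mul_sq_le_sq_mul_sq univ (fun x => √(Z x)) (fun x => √(Z x) ^ 3)
    have e : ∀ x, √(Z x) * √(Z x) ^ 3 = Z x ^ 2 := fun x => by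
      rw [show √(Z x) * √(Z x) ^ 3 = (√(Z x) ^ 2) ^ 2 by ring, Real.sq_sqrt (hZ x)]
    have e' : ∀ x, (√(Z x) ^ 3) ^ 2 = Z x ^ 3 := fun x => by
      rw [show (√(Z x) ^ 3) ^ 2 = (√(Z x) ^ 2) ^ 3 by ring, Real.sq_sqrt (hZ x)]
    simpa only [e, e', Real.sq_sqrt (hZ _)] using this
  have h24 : e3 ^ 2 ≤ e2 * e4 := by
    have := expect_mul_sq_le_sq_mul_sq univ (fun x => Z x) (fun x => Z x ^ 2)
    simpa only [← pow_succ', ← pow_mul] using this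
  rcases p2.eq_or_lt with h0 | h0
  · rw [← h0]; positivity
  have h3 : e3 ^ 2 ≤ κ ^ 2 * e2 ^ 3 := by
    calc _ ≤ e2 * e4 := h24
      _ ≤ e2 * (κ * e2) ^ 2 := by gcongr
      _ = _ := by ring
  have h4 : e2 ^ 3 * e2 ≤ e2 ^ 3 * (κ * e1) ^ 2 := by
    calc _ = (e2 ^ 2) ^ 2 := by ring
      _ ≤ (e1 * e3) ^ 2 := by gcongr
      _ = e1 ^ 2 * e3 ^ 2 := by ring
      _ ≤ e1 ^ 2 * (κ ^ 2 * e2 ^ 3) := by gcongr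
      _ = _ := by ring
  exact le_of_mul_le_mul_left h4 (by positivity)

end Expectation

/-! ### Schur orthogonality and the Bonami induction step. -/

section Schur

/-- The consequences of Schur orthogonality for a nontrivial real orthogonal absolutely irreducible
representation that are used for low degree polynomials in its matrix entries. -/
structure IsSchurFamily {G : Type*} [Fintype G] {d : ℕ} (ρ : G → Matrix (Fin d) (Fin d) ℝ) :
    Prop where
  mul_transpose : ∀ y, ρ y * (ρ y)ᵀ = 1
  expect_apply : ∀ p : Fin d × Fin d, 𝔼 y, ρ y p.1 p.2 = 0
  expect_mul : ∀ p q : Fin d × Fin d,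
    𝔼 y, ρ y p.1 p.2 * ρ y q.1 q.2 = if p = q then (d : ℝ)⁻¹ else 0

variable {ι G : Type*} [Fintype G] {d : ℕ}
  {ρ : G → Matrix (Fin d) (Fin d) ℝ}

theorem IsSchurFamily.sum_sq (hρ : IsSchurFamily ρ) (y : G) :
    ∑ p : Fin d × Fin d, ρ y p.1 p.2 ^ 2 = d := by
  have := congrArg Matrix.trace (hρ.mul_transpose y)
  simpa [Matrix.trace, Matrix.mul_apply, Fintype.sum_prod_type, sq] using this

theorem IsSchurFamily.expect_linear (hρ : IsSchurFamily ρ) (c : Fin d × Fin d → ℝ) :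
    𝔼 y, ∑ p, c p * ρ y p.1 p.2 = 0 := by
  simp [expect_sum_comm, ← mul_expect, hρ.expect_apply]

theorem IsSchurFamily.expect_linear_sq (hρ : IsSchurFamily ρ) (c : Fin d × Fin d → ℝ) :
    𝔼 y, (∑ p, c p * ρ y p.1 p.2) ^ 2 = (∑ p, c p ^ 2) / d := by
  have h : ∀ p q : Fin d × Fin d, 𝔼 y, c p * ρ y p.1 p.2 * (c q * ρ y q.1 q.2)
      = c p * c q * if p = q then (d : ℝ)⁻¹ else 0 := fun p q => by
    rw [← hρ.expect_mul, mul_expect]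
    exact expect_congr rfl fun y _ => mul_mul_mul_comm _ _ _ _
  simp only [sq, sum_mul_sum, expect_sum_comm, h]
  simp [div_eq_mul_inv, sum_mul]

variable [Fintype ι] [DecidableEq ι] [Nonempty G] {u : (ι → G) → ℝ} {H : Fin d × Fin d → (ι → G) → ℝ} {i : ι}

theorem IsSchurFamily.expect_mul_linear (hρ : IsSchurFamily ρ)
    (hu : ∀ x y, u (update x i y) = u x) (hH : ∀ p x y, H p (update x i y) = H p x) :
    𝔼 x, u x * ∑ p, H p x * ρ (x i) p.1 p.2 = 0 := by
  rw [← expect_expect_update i]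
  simp [hu, hH, ← mul_expect, hρ.expect_linear]

theorem IsSchurFamily.expect_mul_linear_sq (hρ : IsSchurFamily ρ)
    (hu : ∀ x y, u (update x i y) = u x) (hH : ∀ p x y, H p (update x i y) = H p x) :
    𝔼 x, u x * (∑ p, H p x * ρ (x i) p.1 p.2) ^ 2 = (𝔼 x, u x * ∑ p, H p x ^ 2) / d := by
  rw [← expect_expect_update i]
  simp [hu, hH, ← mul_expect, hρ.expect_linear_sq, expect_div, mul_div_assoc]

theorem IsSchurFamily.expect_add_linear_sq (hρ : IsSchurFamily ρ)
    (hu : ∀ x y, u (update x i y) = u x) (hH : ∀ p x y, H p (update x i y) = H p x) :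
    𝔼 x, (u x + ∑ p, H p x * ρ (x i) p.1 p.2) ^ 2
      = 𝔼 x, u x ^ 2 + (∑ p, 𝔼 x, H p x ^ 2) / d := by
  have h1 := hρ.expect_mul_linear hu hH
  have h2 := hρ.expect_mul_linear_sq (u := fun _ => 1) (fun _ _ => rfl) hH
  simp only [one_mul, expect_sum_comm] at h2
  simp only [add_sq, expect_add_distrib, h2, mul_assoc, ← mul_expect, h1]
  simp

/-- The inductive step of a Bonami-type inequality: adding a term linear in a fresh variable. -/
theorem IsSchurFamily.fourth_moment_add_linear (hρ : IsSchurFamily ρ) (hd : 1 ≤ d)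
    (hu : ∀ x y, u (update x i y) = u x) (hH : ∀ p x y, H p (update x i y) = H p x)
    {κ : ℝ} (hκ : 0 ≤ κ) (hu4 : 𝔼 x, u x ^ 4 ≤ (4 * d * κ * 𝔼 x, u x ^ 2) ^ 2)
    (hH4 : ∀ p, 𝔼 x, H p x ^ 4 ≤ (κ * 𝔼 x, H p x ^ 2) ^ 2) :
    𝔼 x, (u x + ∑ p, H p x * ρ (x i) p.1 p.2) ^ 4
      ≤ (4 * d * κ * 𝔼 x, (u x + ∑ p, H p x * ρ (x i) p.1 p.2) ^ 2) ^ 2 := by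
  rw [hρ.expect_add_linear_sq hu hH]
  have hd' : (1 : ℝ) ≤ d := by exact_mod_cast hd
  have hN := expect_sum_sq_sq_le univ H hκ hH4
  set N : (ι → G) → ℝ := fun x => ∑ p, H p x ^ 2 with hNdef
  set L : (ι → G) → ℝ := fun x => ∑ p, H p x * ρ (x i) p.1 p.2 with hL
  set f := 𝔼 x, u x ^ 2
  set n := ∑ p, 𝔼 x, H p x ^ 2
  have hf0 : 0 ≤ f := expect_nonneg_of_nonneg fun _ => by positivity
  have hn0 : 0 ≤ n := sum_nonneg fun p _ => expect_nonneg_of_nonneg fun _ => by positivity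
  have hNi : ∀ x y, N (update x i y) = N x := fun x y => by simp [hNdef, hH]
  have h31 : 𝔼 x, u x ^ 3 * L x = 0 :=
    hρ.expect_mul_linear (u := fun x => u x ^ 3) (fun x y => by simp [hu]) hH
  have h22 : 𝔼 x, u x ^ 2 * L x ^ 2 ≤ 4 * d * κ * f * (κ * n) / d := by
    rw [hρ.expect_mul_linear_sq (u := fun x => u x ^ 2) (fun x y => by simp [hu]) hH]
    gcongr
    refine expect_mul_le (by positivity) (by positivity) ?_ hN
    simpa only [← pow_mul] using hu4
  -- Pointwise L² ≤ dN, while averaging L² over the fresh variable gives N/d, so the factors d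
  -- cancel.
  have h4 : 𝔼 x, L x ^ 4 ≤ (κ * n) ^ 2 := by
    calc 𝔼 x, L x ^ 4 ≤ 𝔼 x, d * (N x * L x ^ 2) := by
          refine expect_le_expect fun x _ => ?_
          have : L x ^ 2 ≤ N x * d := by
            rw [← hρ.sum_sq (x i)]
            exact sum_mul_sq_le_sq_mul_sq _ _ _
          nlinarith [sq_nonneg (L x)]
      _ = 𝔼 x, N x ^ 2 := by
          rw [← mul_expect, hρ.expect_mul_linear_sq hNi hH]
          have hd0 : (d : ℝ) ≠ 0 := by positivity
          rw [mul_div_cancel₀ _ hd0]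
          exact expect_congr rfl fun x _ => (sq (N x)).symm
      _ ≤ _ := hN
  calc 𝔼 x, (u x + L x) ^ 4
      -- The moment of uL³ need not vanish; it is absorbed by 4uL³ ≤ 2u²L² + 2L⁴.
      ≤ 𝔼 x, (u x ^ 4 + 4 * (u x ^ 3 * L x) + 8 * (u x ^ 2 * L x ^ 2) + 3 * L x ^ 4) := by
        refine expect_le_expect fun x _ => ?_
        nlinarith [mul_nonneg (sq_nonneg (L x)) (sq_nonneg (u x - L x))]
    _ = 𝔼 x, u x ^ 4 + 4 * 𝔼 x, u x ^ 3 * L x + 8 * 𝔼 x, u x ^ 2 * L x ^ 2 + 3 * 𝔼 x, L x ^ 4 := by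
        simp only [expect_add_distrib, ← mul_expect]
    _ ≤ (4 * d * κ * f) ^ 2 + 4 * 0 + 8 * (4 * d * κ * f * (κ * n) / d) + 3 * (κ * n) ^ 2 := by
        rw [h31]; gcongr
    _ ≤ _ := by
        have e1 : 8 * (4 * d * κ * f * (κ * n) / d) = 32 * (κ ^ 2 * (f * n)) := by
          field_simp; ring
        have e2 : (4 * d * κ * (f + n / d)) ^ 2
            = (4 * d * κ * f) ^ 2 + 32 * (d * (κ ^ 2 * (f * n))) + 16 * (κ * n) ^ 2 := by
          field_simp; ring
        rw [e1, e2]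
        have : κ ^ 2 * (f * n) ≤ d * (κ ^ 2 * (f * n)) :=
          le_mul_of_one_le_left (by positivity) hd'
        nlinarith [sq_nonneg (κ * n)]

end Schur

/-! ### Schur orthogonality for the standard representation of the symmetric group. -/

section StandardRep

theorem Equiv.Perm.expect_comp_apply {m : ℕ} (f : Fin m → ℝ) (i : Fin m) :
    𝔼 x : Equiv.Perm (Fin m), f (x i) = (∑ j, f j) / m := by
  have hm : (m : ℝ) ≠ 0 := by exact_mod_cast (Fin.pos i).ne'
  have h : ∀ k, 𝔼 x : Equiv.Perm (Fin m), f (x k) = 𝔼 x : Equiv.Perm (Fin m), f (x i) :=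
    fun k => Fintype.expect_equiv (Equiv.mulRight (Equiv.swap i k)) _ _ fun x => by simp
  rw [eq_div_iff hm]
  calc (𝔼 x : Equiv.Perm (Fin m), f (x i)) * m
      = ∑ k, 𝔼 x : Equiv.Perm (Fin m), f (x k) := by simp [h, mul_comm]
    _ = 𝔼 x : Equiv.Perm (Fin m), ∑ k, f (x k) := (expect_sum_comm _ _ _).symm
    _ = 𝔼 _x : Equiv.Perm (Fin m), ∑ j, f j := expect_congr rfl fun x _ => Equiv.sum_comp x f
    _ = _ := Fintype.expect_const _

theorem Equiv.Perm.expect_mul_comp_apply {m : ℕ} (hm : 2 ≤ m) (f g : Fin m → ℝ)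
    (hg : ∑ j, g j = 0) (i k : Fin m) :
    𝔼 x : Equiv.Perm (Fin m), f (x i) * g (x k) =
      (∑ j, f j * g j) * ((if i = k then ((m : ℝ) - 1)⁻¹ else 0) - (m * ((m : ℝ) - 1))⁻¹) := by
  have hm0 : (m : ℝ) ≠ 0 := by positivity
  have hm1 : (m : ℝ) - 1 ≠ 0 := by
    have : (2 : ℝ) ≤ m := by exact_mod_cast hm
    linarith
  have hii : 𝔼 x : Equiv.Perm (Fin m), f (x i) * g (x i) = (∑ j, f j * g j) / m :=
    Equiv.Perm.expect_comp_apply (fun j => f j * g j) i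
  by_cases hik : i = k
  · subst hik
    rw [hii, if_pos rfl]
    field_simp
  · rw [if_neg hik]
    have h : ∀ l ∈ univ.erase i, 𝔼 x : Equiv.Perm (Fin m), f (x i) * g (x l)
        = 𝔼 x : Equiv.Perm (Fin m), f (x i) * g (x k) := fun l hl =>
      Fintype.expect_equiv (Equiv.mulRight (Equiv.swap k l)) _ _ fun x => by
        simp [Equiv.swap_apply_of_ne_of_ne hik (ne_of_mem_erase hl).symm]
    have hsum : ((m : ℝ) - 1) * 𝔼 x : Equiv.Perm (Fin m), f (x i) * g (x k)
        = -((∑ j, f j * g j) / m) := by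
      have hcard : ((univ.erase i).card : ℝ) = m - 1 := by
        rw [card_erase_of_mem (mem_univ i), card_univ, Fintype.card_fin,
          Nat.cast_sub (by omega), Nat.cast_one]
      rw [← hcard, ← nsmul_eq_mul, ← sum_const, ← sum_congr rfl h, ← expect_sum_comm, ← hii,
        ← expect_neg_distrib]
      refine expect_congr rfl fun x _ => ?_
      rw [← mul_sum]
      have : ∑ l, g (x l) = 0 := (Equiv.sum_comp x g).trans hg
      rw [← add_sum_erase _ _ (mem_univ i)] at this
      rw [← mul_neg, eq_neg_of_add_eq_zero_right this]
    field_simp at hsum ⊢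
    linarith

/-- No representation theory is needed: ρ(x)ₐᵦ = ∑ᵢ Vᵢₐ V₍ₓᵢ₎ᵦ, where V consists of the last m - 1
columns of U. These are orthonormal with zero column sums, so one- and two-point averages over
permutations suffice. -/
theorem SymmFKN.IsStandardRep.isSchurFamily {m : ℕ} (hm : 2 ≤ m)
    {ρ : Equiv.Perm (Fin m) → Matrix (Fin (m - 1)) (Fin (m - 1)) ℝ} (h : IsStandardRep ρ) :
    IsSchurFamily ρ := by
  obtain ⟨U, h1, h2, h3⟩ := h
  set B : Equiv.Perm (Fin m) → Matrix (Unit ⊕ Fin (m - 1)) (Unit ⊕ Fin (m - 1)) ℝ :=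
    fun x => Matrix.fromBlocks 1 0 0 (ρ x) with hBdef
  replace h3 : ∀ x : Equiv.Perm (Fin m), x.permMatrix ℝ = U * B x * Uᵀ := h3
  have hPU : ∀ x : Equiv.Perm (Fin m),
      U.submatrix x id = U * B x := fun x => by
    rw [← PEquiv.toMatrix_toPEquiv_mul]
    change x.permMatrix ℝ * U = _
    rw [h3, Matrix.mul_assoc, h2, Matrix.mul_one]
  have hB : ∀ x : Equiv.Perm (Fin m),
      Uᵀ * U.submatrix x id = B x := fun x => by
    rw [hPU, ← Matrix.mul_assoc, h2, Matrix.one_mul]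
  set V : Fin m → Fin (m - 1) → ℝ := fun i a => U i (Sum.inr a) with hV
  have hρ : ∀ x a b, ρ x a b = ∑ i, V i a * V (x i) b := fun x a b => by
    have := congrFun (congrFun (hB x) (Sum.inr a)) (Sum.inr b)
    simpa [Matrix.mul_apply, hBdef] using this.symm
  have hu : ∀ (x : Equiv.Perm (Fin m)) i, U (x i) (Sum.inl ()) = U i (Sum.inl ()) := fun x i => by
    have := congrFun (congrFun (hPU x) i) (Sum.inl ())
    simpa [Matrix.mul_apply, hBdef] using this
  let i₀ : Fin m := ⟨0, by omega⟩
  -- The first column is fixed by all permutations, hence constant; orthogonality to it is what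
  -- makes the other columns sum to zero.
  have hu' : ∀ i, U i (Sum.inl ()) = U i₀ (Sum.inl ()) := fun i => by
    simpa using hu (Equiv.swap i₀ i) i₀
  have huu := congrFun (congrFun h2 (Sum.inl ())) (Sum.inl ())
  have hV0 : ∀ a, ∑ i, V i a = 0 := fun a => by
    have := congrFun (congrFun h2 (Sum.inl ())) (Sum.inr a)
    simp only [Matrix.mul_apply, Matrix.transpose_apply, hu', ← mul_sum] at this huu
    rcases mul_eq_zero.mp (this.trans (by simp)) with h0 | h0
    · simp [h0] at huu
    · exact h0
  have hVV : ∀ a b, ∑ i, V i a * V i b = if a = b then 1 else 0 := fun a b => by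
    have := congrFun (congrFun h2 (Sum.inr a)) (Sum.inr b)
    simpa [Matrix.mul_apply, Matrix.one_apply] using this
  refine ⟨fun y => ?_, fun p => ?_, fun p q => ?_⟩
  · have hBB : B y * (B y)ᵀ = 1 := by
      rw [← hB, Matrix.transpose_mul, Matrix.transpose_transpose, ← Matrix.mul_assoc,
        Matrix.mul_assoc Uᵀ, Matrix.transpose_submatrix,
        Matrix.submatrix_mul _ _ _ id _ bijective_id |>.symm, h1,
        Matrix.submatrix_one _ y.injective, Matrix.mul_one, h2]
    simp only [hBdef] at hBB
    rw [Matrix.fromBlocks_transpose, Matrix.fromBlocks_multiply, ← Matrix.fromBlocks_one,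
      Matrix.fromBlocks_inj] at hBB
    simpa using hBB.2.2.2
  · simp only [hρ, expect_sum_comm, ← mul_expect,
      Equiv.Perm.expect_comp_apply (fun j => V j p.2), hV0]
    simp
  · have hcast : ((m - 1 : ℕ) : ℝ) = m - 1 := by rw [Nat.cast_sub (by omega), Nat.cast_one]
    have hE : ∀ i k, 𝔼 x : Equiv.Perm (Fin m), V i p.1 * V (x i) p.2 * (V k q.1 * V (x k) q.2)
        = (if p.2 = q.2 then 1 else 0) * (V i p.1 * (V k q.1 * if i = k then ((m : ℝ) - 1)⁻¹ else 0)
          - V i p.1 * (V k q.1 * (m * ((m : ℝ) - 1))⁻¹)) := fun i k => by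
      simp only [mul_mul_mul_comm (V i p.1), ← mul_expect, Equiv.Perm.expect_mul_comp_apply hm
        (fun j => V j p.2) (fun j => V j q.2) (hV0 q.2), hVV]
      ring
    simp only [hρ, sum_mul_sum, expect_sum_comm, hE, hcast]
    simp only [← mul_sum, sum_sub_distrib, ← sum_mul,
      hV0, mul_ite, mul_zero, sum_ite_eq, mem_univ, if_true]
    simp only [← mul_assoc, ← sum_mul, hVV, Prod.ext_iff]
    by_cases ha : p.1 = q.1 <;> by_cases hb : p.2 = q.2 <;> simp [ha, hb]

end StandardRep

/-! ### Moments of linear functions and of their quadratic part. -/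

section LowDegree

variable {ι G : Type*} {d : ℕ}

/-- The squared Frobenius norm. -/
def frobSq (B : Matrix (Fin d) (Fin d) ℝ) : ℝ := ∑ k, ∑ l, B k l ^ 2

theorem frobSq_nonneg (B : Matrix (Fin d) (Fin d) ℝ) : 0 ≤ frobSq B :=
  sum_nonneg fun _ _ => sum_nonneg fun _ _ => sq_nonneg _

/-- The partial sum over `S` of the linear function with coefficients `A`. -/
def linPart (ρ : G → Matrix (Fin d) (Fin d) ℝ) (A : ι → Matrix (Fin d) (Fin d) ℝ) (S : Finset ι)
    (x : ι → G) : Matrix (Fin d) (Fin d) ℝ := ∑ i ∈ S, A i * ρ (x i)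

/-- The off-diagonal part of `h hᵀ` for a linear function `h`. -/
def quadPart (ρ : G → Matrix (Fin d) (Fin d) ℝ) (A : ι → Matrix (Fin d) (Fin d) ℝ) (S : Finset ι)
    (x : ι → G) : Matrix (Fin d) (Fin d) ℝ :=
  linPart ρ A S x * (linPart ρ A S x)ᵀ - ∑ i ∈ S, A i * (A i)ᵀ

/-- The coefficient of `ρ (x a) c b` in the `(k, l)` entry of `L (A ρ)ᵀ + (A ρ) Lᵀ`. -/
def crossCoeff (L A : Matrix (Fin d) (Fin d) ℝ) (k l : Fin d) (p : Fin d × Fin d) : ℝ :=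
  L k p.2 * A l p.1 + L l p.2 * A k p.1

/-- Expanding the square, each pure term sums to |A|²|L|², and the mixed term is 2|LᵀA|² ≥ 0. -/
theorem two_mul_frobSq_mul_le (L A : Matrix (Fin d) (Fin d) ℝ) :
    2 * (frobSq A * frobSq L) ≤ ∑ k, ∑ l, ∑ p, crossCoeff L A k l p ^ 2 := by
  have h1 : ∑ k, ∑ l, ∑ p : Fin d × Fin d, L k p.2 ^ 2 * A l p.1 ^ 2 = frobSq A * frobSq L := by
    rw [mul_comm, frobSq, frobSq, sum_mul_sum]
    exact sum_congr rfl fun k _ => sum_congr rfl fun l _ => by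
      rw [sum_mul_sum, Fintype.sum_prod_type_right]
  have h2 : ∑ k, ∑ l, ∑ p : Fin d × Fin d, L l p.2 ^ 2 * A k p.1 ^ 2 = frobSq A * frobSq L := by
    rw [sum_comm, h1]
  have h3 : 0 ≤ ∑ k, ∑ l, ∑ p : Fin d × Fin d, (L k p.2 * A k p.1) * (L l p.2 * A l p.1) := by
    have : ∑ k, ∑ l, ∑ p : Fin d × Fin d, (L k p.2 * A k p.1) * (L l p.2 * A l p.1)
        = ∑ p : Fin d × Fin d, (∑ k, L k p.2 * A k p.1) ^ 2 := by
      simp only [sq, sum_mul_sum]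
      rw [sum_comm' (t' := univ) (s' := fun _ => univ) (by simp)]
      rw [sum_comm]
      refine Eq.trans (sum_congr rfl fun k _ => sum_comm) ?_
      rw [sum_comm]
    rw [this]
    exact sum_nonneg fun _ _ => sq_nonneg _
  have h4 : ∑ k, ∑ l, ∑ p, crossCoeff L A k l p ^ 2
      = ∑ k, ∑ l, ∑ p : Fin d × Fin d, L k p.2 ^ 2 * A l p.1 ^ 2
        + ∑ k, ∑ l, ∑ p : Fin d × Fin d, L l p.2 ^ 2 * A k p.1 ^ 2
        + 2 * ∑ k, ∑ l, ∑ p : Fin d × Fin d, (L k p.2 * A k p.1) * (L l p.2 * A l p.1) := by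
    simp only [mul_sum, ← sum_add_distrib, crossCoeff]
    exact sum_congr rfl fun k _ => sum_congr rfl fun l _ => sum_congr rfl fun p _ => by ring
  rw [h4, h1, h2]
  linarith

variable {ρ : G → Matrix (Fin d) (Fin d) ℝ} {A : ι → Matrix (Fin d) (Fin d) ℝ} {S : Finset ι}

theorem linPart_apply (S : Finset ι) (x : ι → G) (k b : Fin d) :
    linPart ρ A S x k b = ∑ i ∈ S, ∑ c, A i k c * ρ (x i) c b := by
  simp [linPart, Matrix.sum_apply, Matrix.mul_apply]

theorem crossCoeff_linPart (x : ι → G) (B : Matrix (Fin d) (Fin d) ℝ) (k l : Fin d)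
    (p : Fin d × Fin d) : crossCoeff (linPart ρ A S x) B k l p =
      ∑ i ∈ S, ∑ q : Fin d × Fin d,
        (if q.2 = p.2 then A i k q.1 * B l p.1 + A i l q.1 * B k p.1 else 0)
          * ρ (x i) q.1 q.2 := by
  simp only [crossCoeff, linPart_apply, sum_mul, ← sum_add_distrib, Fintype.sum_prod_type, ite_mul,
    zero_mul, sum_ite_eq', mem_univ, if_true]
  exact sum_congr rfl fun i _ => sum_congr rfl fun c _ => by ring

variable [DecidableEq ι] {a : ι}

theorem linPart_update (ha : a ∉ S) (x : ι → G) (y : G) :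
    linPart ρ A S (update x a y) = linPart ρ A S x :=
  sum_congr rfl fun i hi => by rw [update_of_ne (ne_of_mem_of_not_mem hi ha)]

theorem quadPart_update (ha : a ∉ S) (x : ι → G) (y : G) :
    quadPart ρ A S (update x a y) = quadPart ρ A S x := by
  simp [quadPart, linPart_update ha]

variable [Fintype G]

/-- The diagonal term of the new variable is constant because ρρᵀ = 1, so that variable enters only
linearly; this drives the inductions below. -/
theorem quadPart_insert (hρ : IsSchurFamily ρ) (ha : a ∉ S) (x : ι → G) (k l : Fin d) :
    quadPart ρ A (insert a S) x k l = quadPart ρ A S x k l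
      + ∑ p, crossCoeff (linPart ρ A S x) (A a) k l p * ρ (x a) p.1 p.2 := by
  have hL : linPart ρ A (insert a S) x = A a * ρ (x a) + linPart ρ A S x := sum_insert ha
  have hA : A a * ρ (x a) * (A a * ρ (x a))ᵀ = A a * (A a)ᵀ := by
    rw [Matrix.transpose_mul, Matrix.mul_assoc, ← Matrix.mul_assoc (ρ (x a)), hρ.mul_transpose,
      Matrix.one_mul]
  have hQ : quadPart ρ A (insert a S) x = quadPart ρ A S x
      + (linPart ρ A S x * (A a * ρ (x a))ᵀ + A a * ρ (x a) * (linPart ρ A S x)ᵀ) := by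
    rw [quadPart, hL, sum_insert ha, Matrix.transpose_add, Matrix.add_mul, Matrix.mul_add,
      Matrix.mul_add, hA, quadPart]
    abel
  rw [hQ, Matrix.add_apply, Matrix.add_apply, Matrix.mul_apply, Matrix.mul_apply]
  simp only [Matrix.transpose_apply, Matrix.mul_apply, mul_sum, sum_mul, ← sum_add_distrib,
    Fintype.sum_prod_type_right, crossCoeff]
  congr 1
  exact sum_congr rfl fun b _ => sum_congr rfl fun c _ => by ring

variable [Fintype ι] [Nonempty G]

theorem IsSchurFamily.expect_linear_sum_sq (hρ : IsSchurFamily ρ) (w : ι → Fin d × Fin d → ℝ)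
    (S : Finset ι) : 𝔼 x : ι → G, (∑ i ∈ S, ∑ p, w i p * ρ (x i) p.1 p.2) ^ 2
      = (∑ i ∈ S, ∑ p, w i p ^ 2) / d := by
  induction S using Finset.induction_on with
  | empty => simp
  | insert a S ha ih =>
    have hu : ∀ (x : ι → G) y, ∑ i ∈ S, ∑ p, w i p * ρ (update x a y i) p.1 p.2
        = ∑ i ∈ S, ∑ p, w i p * ρ (x i) p.1 p.2 := fun x y =>
      sum_congr rfl fun i hi => by rw [update_of_ne (ne_of_mem_of_not_mem hi ha)]
    have := hρ.expect_add_linear_sq (H := fun p _ => w a p) (i := a)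
      (u := fun x => ∑ i ∈ S, ∑ p, w i p * ρ (x i) p.1 p.2) hu (fun _ _ _ => rfl)
    simp only [sum_insert ha, add_comm (∑ p, w a p * _), this, ih, Fintype.expect_const]
    ring

theorem IsSchurFamily.fourth_moment_linear_sum (hρ : IsSchurFamily ρ) (hd : 1 ≤ d)
    (w : ι → Fin d × Fin d → ℝ) (S : Finset ι) :
    𝔼 x : ι → G, (∑ i ∈ S, ∑ p, w i p * ρ (x i) p.1 p.2) ^ 4
      ≤ (4 * d * 𝔼 x : ι → G, (∑ i ∈ S, ∑ p, w i p * ρ (x i) p.1 p.2) ^ 2) ^ 2 := by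
  induction S using Finset.induction_on with
  | empty => simp
  | insert a S ha ih =>
    have hu : ∀ (x : ι → G) y, ∑ i ∈ S, ∑ p, w i p * ρ (update x a y i) p.1 p.2
        = ∑ i ∈ S, ∑ p, w i p * ρ (x i) p.1 p.2 := fun x y =>
      sum_congr rfl fun i hi => by rw [update_of_ne (ne_of_mem_of_not_mem hi ha)]
    have := hρ.fourth_moment_add_linear (H := fun p _ => w a p) (i := a)
      (u := fun x => ∑ i ∈ S, ∑ p, w i p * ρ (x i) p.1 p.2) hd hu (fun _ _ _ => rfl)
      zero_le_one (by simpa using ih) (fun p => by simp [← pow_mul])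
    simpa only [sum_insert ha, add_comm (∑ p, w a p * _), mul_one] using this

theorem IsSchurFamily.expect_frobSq_linPart (hρ : IsSchurFamily ρ) (hd : 1 ≤ d) (S : Finset ι) :
    𝔼 x, frobSq (linPart ρ A S x) = ∑ i ∈ S, frobSq (A i) := by
  have hd' : (d : ℝ) ≠ 0 := by positivity
  have h : ∀ k b, 𝔼 x : ι → G, (linPart ρ A S x k b) ^ 2 = (∑ i ∈ S, ∑ c, A i k c ^ 2) / d := by
    intro k b
    have := hρ.expect_linear_sum_sq (fun i p => if p.2 = b then A i k p.1 else 0) S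
    simpa [Fintype.sum_prod_type, linPart_apply, ite_pow] using this
  simp only [frobSq, expect_sum_comm, h]
  simp only [sum_const, card_univ, Fintype.card_fin, nsmul_eq_mul, mul_div_cancel₀ _ hd']
  exact sum_comm

/-- The coefficients of each new variable are themselves linear functions, with constant 4d; the
induction step costs another 4d. -/
theorem IsSchurFamily.fourth_moment_quadPart (hρ : IsSchurFamily ρ) (hd : 1 ≤ d) (S : Finset ι)
    (k l : Fin d) : 𝔼 x : ι → G, (quadPart ρ A S x k l) ^ 4
      ≤ (4 * d * (4 * d) * 𝔼 x : ι → G, (quadPart ρ A S x k l) ^ 2) ^ 2 := by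
  induction S using Finset.induction_on with
  | empty => simp [quadPart, linPart]
  | insert a S ha ih =>
    simp only [quadPart_insert hρ ha]
    refine hρ.fourth_moment_add_linear
      (H := fun p x => crossCoeff (linPart ρ A S x) (A a) k l p) hd
      (fun x y => by rw [quadPart_update ha]) (fun p x y => by rw [linPart_update ha])
      (by positivity) ih fun p => ?_
    simp only [crossCoeff_linPart]
    exact hρ.fourth_moment_linear_sum hd _ S

/-- Inserting a variable adds an orthogonal term, contributing at least twice its mass times the
mass already present; these add up to the sum over pairs i ≠ j. -/
theorem IsSchurFamily.le_expect_frobSq_quadPart (hρ : IsSchurFamily ρ) (hd : 1 ≤ d)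
    (S : Finset ι) : (∑ i ∈ S, frobSq (A i)) ^ 2 - ∑ i ∈ S, frobSq (A i) ^ 2
      ≤ d * 𝔼 x : ι → G, frobSq (quadPart ρ A S x) := by
  have hd' : (0 : ℝ) < d := by positivity
  induction S using Finset.induction_on with
  | empty => simp [quadPart, linPart, frobSq]
  | insert a S ha ih =>
    have h1 : 𝔼 x : ι → G, frobSq (quadPart ρ A (insert a S) x)
        = 𝔼 x : ι → G, frobSq (quadPart ρ A S x)
          + (𝔼 x : ι → G, ∑ k, ∑ l, ∑ p, crossCoeff (linPart ρ A S x) (A a) k l p ^ 2) / d := by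
      have h : ∀ k l, 𝔼 x : ι → G, (quadPart ρ A (insert a S) x k l) ^ 2
          = 𝔼 x : ι → G, (quadPart ρ A S x k l) ^ 2
            + (∑ p, 𝔼 x : ι → G, crossCoeff (linPart ρ A S x) (A a) k l p ^ 2) / d := fun k l => by
        simp only [quadPart_insert hρ ha]
        exact hρ.expect_add_linear_sq
          (H := fun p x => crossCoeff (linPart ρ A S x) (A a) k l p)
          (fun x y => by rw [quadPart_update ha]) (fun p x y => by rw [linPart_update ha])
      simp only [frobSq, expect_sum_comm, h, sum_add_distrib, sum_div]
    have h2 : 2 * (frobSq (A a) * ∑ i ∈ S, frobSq (A i))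
        ≤ 𝔼 x : ι → G, ∑ k, ∑ l, ∑ p, crossCoeff (linPart ρ A S x) (A a) k l p ^ 2 := by
      rw [← hρ.expect_frobSq_linPart hd S, mul_expect, mul_expect]
      exact expect_le_expect fun x _ => two_mul_frobSq_mul_le _ _
    rw [h1, mul_add, mul_div_cancel₀ _ hd'.ne', sum_insert ha, sum_insert ha]
    linarith

/-- Reverse Hölder inequality for the off-diagonal quadratic part. -/
theorem IsSchurFamily.expect_frobSq_quadPart_le (hρ : IsSchurFamily ρ) (hd : 1 ≤ d)
    (S : Finset ι) : 𝔼 x : ι → G, frobSq (quadPart ρ A S x)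
      ≤ (16 * d ^ 2 * 𝔼 x : ι → G, √(frobSq (quadPart ρ A S x))) ^ 2 := by
  have hsq : ∀ x : ι → G, √(frobSq (quadPart ρ A S x)) ^ 2 = frobSq (quadPart ρ A S x) :=
    fun x => Real.sq_sqrt (frobSq_nonneg _)
  have hκ : (4 * d * (4 * d) : ℝ) = 16 * d ^ 2 := by ring
  have h := expect_sum_sq_sq_le (univ : Finset (Fin d × Fin d))
    (fun p (x : ι → G) => quadPart ρ A S x p.1 p.2) (κ := 4 * d * (4 * d)) (by positivity)
    fun p => hρ.fourth_moment_quadPart hd S p.1 p.2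
  rw [← expect_sum_comm] at h
  have h' := expect_sq_le_of_fourth_moment (Z := fun x : ι → G => √(frobSq (quadPart ρ A S x)))
    (κ := 4 * d * (4 * d)) (fun x => Real.sqrt_nonneg _) (by
      simp only [show ∀ r : ℝ, r ^ 4 = (r ^ 2) ^ 2 from fun r => by ring, hsq]
      simpa only [Fintype.sum_prod_type, frobSq] using h)
  simpa only [hsq, hκ] using h'

end LowDegree

/-! ### Orthogonal projection on the linear functions. -/

section Projection

variable {d : ℕ}

/-- The Frobenius inner product. -/
def frobInner (X Y : Matrix (Fin d) (Fin d) ℝ) : ℝ := ∑ k, ∑ l, X k l * Y k l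

theorem frobSq_sub (X Y : Matrix (Fin d) (Fin d) ℝ) :
    frobSq (X - Y) = frobSq X - 2 * frobInner X Y + frobSq Y := by
  simp only [frobSq, frobInner, mul_sum, ← sum_sub_distrib, ← sum_add_distrib, Matrix.sub_apply]
  exact sum_congr rfl fun _ _ => sum_congr rfl fun _ _ => by ring

theorem frobInner_mul_right (X B R : Matrix (Fin d) (Fin d) ℝ) :
    frobInner X (B * R) = frobInner (X * Rᵀ) B := by
  simp only [frobInner, Matrix.mul_apply, Matrix.transpose_apply, mul_sum, sum_mul]
  refine sum_congr rfl fun k _ => ?_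
  rw [sum_comm]
  exact sum_congr rfl fun _ _ => sum_congr rfl fun _ _ => by ring

theorem trace_mul_transpose_eq_frobSq (X : Matrix (Fin d) (Fin d) ℝ) :
    (X * Xᵀ).trace = frobSq X := by
  simp [Matrix.trace, Matrix.mul_apply, frobSq, sq]

variable {ι G : Type*} [Fintype ι] [DecidableEq ι] [Fintype G] {ρ : G → Matrix (Fin d) (Fin d) ℝ}

/-- The coefficients of the orthogonal projection of `g` on the linear functions. -/
noncomputable def projCoeff (ρ : G → Matrix (Fin d) (Fin d) ℝ)
    (g : (ι → G) → Matrix (Fin d) (Fin d) ℝ) (i : ι) : Matrix (Fin d) (Fin d) ℝ :=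
  Matrix.of fun k c => 𝔼 x, (g x * (ρ (x i))ᵀ) k c

theorem expect_frobInner_linPart (g : (ι → G) → Matrix (Fin d) (Fin d) ℝ)
    (B : ι → Matrix (Fin d) (Fin d) ℝ) :
    𝔼 x, frobInner (g x) (linPart ρ B univ x) = ∑ i, frobInner (projCoeff ρ g i) (B i) := by
  have h : ∀ x, frobInner (g x) (linPart ρ B univ x)
      = ∑ i, frobInner (g x * (ρ (x i))ᵀ) (B i) := fun x => by
    simp only [← frobInner_mul_right]
    simp only [frobInner, linPart, Matrix.sum_apply, mul_sum]
    rw [sum_comm (s := (univ : Finset ι))]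
    exact sum_congr rfl fun k _ => sum_comm
  simp only [h, expect_sum_comm]
  simp only [frobInner, expect_sum_comm, projCoeff, Matrix.of_apply, expect_mul]

theorem IsSchurFamily.expect_frobSq_sub_linPart [Nonempty G]
    (hρ : IsSchurFamily ρ) (hd : 1 ≤ d) (g : (ι → G) → Matrix (Fin d) (Fin d) ℝ)
    (B : ι → Matrix (Fin d) (Fin d) ℝ) :
    𝔼 x, frobSq (g x - linPart ρ B univ x) = 𝔼 x, frobSq (g x)
      - ∑ i, frobSq (projCoeff ρ g i) + ∑ i, frobSq (projCoeff ρ g i - B i) := by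
  simp only [frobSq_sub, expect_add_distrib, expect_sub_distrib, ← mul_expect,
    expect_frobInner_linPart, hρ.expect_frobSq_linPart hd, sum_add_distrib, sum_sub_distrib,
    ← mul_sum]
  ring

end Projection

/-! ### The quadratic part is small in L¹. -/

section Frobenius

open scoped Matrix.Norms.Frobenius

variable {d : ℕ}

theorem Matrix.frobenius_norm_eq_sqrt (X : Matrix (Fin d) (Fin d) ℝ) : ‖X‖ = √(frobSq X) := by
  rw [Matrix.frobenius_norm_def, Real.sqrt_eq_rpow, frobSq]
  simp

theorem Matrix.frobenius_norm_expect_le {Ω : Type*} [Fintype Ω]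
    (X : Ω → Matrix (Fin d) (Fin d) ℝ) : ‖𝔼 x, X x‖ ≤ 𝔼 x, ‖X x‖ :=
  le_expect_of_subadditive norm_zero norm_add_le fun q Y => by
    have h : (q : ℚ≥0)⁻¹ • Y = (q : ℝ)⁻¹ • Y := by
      ext k l
      simp [NNRat.smul_def]
    rw [h, norm_smul, NNRat.smul_def, norm_inv, Real.norm_natCast]
    simp

theorem Matrix.expect_frobenius_norm_sub_expect_le {Ω : Type*} [Fintype Ω] [Nonempty Ω]
    (X : Ω → Matrix (Fin d) (Fin d) ℝ) : 𝔼 x, ‖X x - 𝔼 y, X y‖ ≤ 2 * 𝔼 x, ‖X x‖ := by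
  calc 𝔼 x, ‖X x - 𝔼 y, X y‖ ≤ 𝔼 x, (‖X x‖ + 𝔼 y, ‖X y‖) := by
        refine expect_le_expect fun x _ => (norm_sub_le _ _).trans ?_
        gcongr
        exact Matrix.frobenius_norm_expect_le X
    _ = _ := by rw [expect_add_distrib, Fintype.expect_const, two_mul]

variable {ι G : Type*} [Fintype ι] [DecidableEq ι] [Fintype G] [Nonempty G]
  {ρ : G → Matrix (Fin d) (Fin d) ℝ} {A : ι → Matrix (Fin d) (Fin d) ℝ}

theorem IsSchurFamily.expect_quadPart (hρ : IsSchurFamily ρ) (S : Finset ι) (k l : Fin d) :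
    𝔼 x : ι → G, quadPart ρ A S x k l = 0 := by
  induction S using Finset.induction_on with
  | empty => simp [quadPart, linPart]
  | insert a S ha ih =>
    simp only [quadPart_insert hρ ha, expect_add_distrib, ih, zero_add]
    have := hρ.expect_mul_linear (i := a) (u := fun _ : ι → G => 1)
      (H := fun p x => crossCoeff (linPart ρ A S x) (A a) k l p) (fun _ _ => rfl)
      (fun p x y => by rw [linPart_update ha])
    simpa only [one_mul] using this

/-- If `g gᵀ` is constant and `g` is `L²`-close to a linear function, then the off-diagonal part
of that linear function is `L¹`-small. -/
theorem IsSchurFamily.expect_sqrt_frobSq_quadPart_le (hρ : IsSchurFamily ρ)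
    {g : (ι → G) → Matrix (Fin d) (Fin d) ℝ} {M : Matrix (Fin d) (Fin d) ℝ} (hM : M.trace = 1)
    (hg : ∀ x, g x * (g x)ᵀ = M) {t : ℝ} (ht1 : t ≤ 1)
    (ht : 𝔼 x, frobSq (g x - linPart ρ A univ x) = t) :
    𝔼 x : ι → G, √(frobSq (quadPart ρ A univ x)) ≤ 6 * √t := by
  have ht0 : 0 ≤ t := ht ▸ expect_nonneg_of_nonneg fun x => frobSq_nonneg _
  set h := linPart ρ A (univ : Finset ι)
  have hg1 : ∀ x, ‖g x‖ = 1 := fun x => by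
    rw [Matrix.frobenius_norm_eq_sqrt, ← trace_mul_transpose_eq_frobSq, hg, hM, Real.sqrt_one]
  have hf2 : 𝔼 x, ‖g x - h x‖ ^ 2 = t := by
    rw [← ht]
    exact expect_congr rfl fun x _ => by
      rw [Matrix.frobenius_norm_eq_sqrt, Real.sq_sqrt (frobSq_nonneg _)]
  have hf1 : 𝔼 x, ‖g x - h x‖ ≤ √t := by
    refine Real.le_sqrt_of_sq_le ?_
    have := expect_mul_sq_le_sq_mul_sq univ (fun _ : ι → G => (1 : ℝ)) (fun x => ‖g x - h x‖)
    simpa [hf2] using this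
  have hX : ∀ x, ‖h x * (h x)ᵀ - M‖ ≤ 2 * ‖g x - h x‖ + ‖g x - h x‖ ^ 2 := fun x => by
    set f := g x - h x with hf
    have e : h x * (h x)ᵀ - M = f * fᵀ - (g x * fᵀ + f * (g x)ᵀ) := by
      have : h x = g x - f := by rw [hf]; abel
      rw [this, Matrix.transpose_sub, Matrix.sub_mul, Matrix.mul_sub, Matrix.mul_sub, hg]
      abel
    have n1 : ‖f * fᵀ‖ ≤ ‖f‖ * ‖f‖ :=
      (Matrix.frobenius_norm_mul _ _).trans_eq (by rw [Matrix.frobenius_norm_transpose])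
    have n2 : ‖g x * fᵀ‖ ≤ ‖f‖ := (Matrix.frobenius_norm_mul _ _).trans_eq (by
      rw [Matrix.frobenius_norm_transpose, hg1, one_mul])
    have n3 : ‖f * (g x)ᵀ‖ ≤ ‖f‖ := (Matrix.frobenius_norm_mul _ _).trans_eq (by
      rw [Matrix.frobenius_norm_transpose, hg1, mul_one])
    rw [e]
    have := norm_sub_le (f * fᵀ) (g x * fᵀ + f * (g x)ᵀ)
    have := norm_add_le (g x * fᵀ) (f * (g x)ᵀ)
    nlinarith
  have hXE : 𝔼 x, ‖h x * (h x)ᵀ - M‖ ≤ 3 * √t := by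
    calc _ ≤ 𝔼 x, (2 * ‖g x - h x‖ + ‖g x - h x‖ ^ 2) := expect_le_expect fun x _ => hX x
      _ = 2 * 𝔼 x, ‖g x - h x‖ + t := by rw [expect_add_distrib, ← mul_expect, hf2]
      _ ≤ 2 * √t + √t := by
        gcongr
        refine Real.le_sqrt_of_sq_le ?_
        nlinarith
      _ = _ := by ring
  have hc : 𝔼 x, (h x * (h x)ᵀ - M) = ∑ i, A i * (A i)ᵀ - M := by
    have hq : ∀ x, h x * (h x)ᵀ - M = quadPart ρ A univ x + (∑ i, A i * (A i)ᵀ - M) := fun x => by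
      rw [quadPart]; abel
    have h0 : 𝔼 x : ι → G, quadPart ρ A univ x = 0 := by
      ext k l
      have := hρ.expect_quadPart (A := A) univ k l
      rw [expect_eq_sum_div_card] at this
      have hcard : ((univ : Finset (ι → G)).card : ℝ) ≠ 0 := by simp
      rw [div_eq_zero_iff, or_iff_left hcard] at this
      rw [expect, Matrix.smul_apply, Matrix.sum_apply, this, smul_zero, Matrix.zero_apply]
    rw [expect_congr rfl fun x _ => hq x, expect_add_distrib, Fintype.expect_const, h0, zero_add]
  -- The quadratic part is h hᵀ - M minus its mean, and centring at most doubles the L¹ norm.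
  calc 𝔼 x : ι → G, √(frobSq (quadPart ρ A univ x))
      = 𝔼 x, ‖(h x * (h x)ᵀ - M) - 𝔼 y, (h y * (h y)ᵀ - M)‖ := by
        refine expect_congr rfl fun x _ => ?_
        rw [hc, ← Matrix.frobenius_norm_eq_sqrt, quadPart]
        congr 1
        abel
    _ ≤ 2 * (3 * √t) := (Matrix.expect_frobenius_norm_sub_expect_le _).trans (by gcongr)
    _ = _ := by ring

end Frobenius

/-! ### The dominant coefficient and the conclusion. -/

section Main

/-- Take the largest aᵢ: ∑ aⱼ² ≤ aᵢ ∑ aⱼ gives (1 - t)(1 - t - aᵢ) ≤ Kt when t ≤ 1/2. For t ≥ 1/2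
the bound is trivial, as 3Kt ≥ 1. -/
theorem exists_one_sub_le {ι : Type*} [Fintype ι] [Nonempty ι] {a : ι → ℝ} (ha : ∀ i, 0 ≤ a i)
    {t K : ℝ} (hK : 1 ≤ K) (ht : 0 ≤ t) (hs : ∑ i, a i = 1 - t)
    (h : t ≤ 1 → (∑ i, a i) ^ 2 - ∑ i, a i ^ 2 ≤ K * t) : ∃ i, 1 - a i ≤ 3 * K * t := by
  obtain ⟨i, -, hi⟩ := exists_max_image univ a univ_nonempty
  refine ⟨i, ?_⟩
  have hai := ha i
  rcases le_total t (1 / 2) with h2 | h2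
  · have h3 : ∑ j, a j ^ 2 ≤ a i * ∑ j, a j := by
      rw [mul_sum]
      refine sum_le_sum fun j _ => ?_
      rw [sq]
      exact mul_le_mul_of_nonneg_right (hi j (mem_univ j)) (ha j)
    have h4 := h (by linarith)
    rw [hs] at h3 h4
    have h5 : (1 - t) * (1 - t - a i) ≤ K * t := by nlinarith
    rcases le_total (1 - t - a i) 0 with h6 | h6 <;> nlinarith
  · nlinarith

theorem sqNorm_sub_linFun {m n d : ℕ} {ρ : Equiv.Perm (Fin m) → Matrix (Fin d) (Fin d) ℝ}
    (hρ : IsSchurFamily ρ) (hd : 1 ≤ d) {g : (Fin n → Equiv.Perm (Fin m)) → Matrix (Fin d) (Fin d) ℝ}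
    {M : Matrix (Fin d) (Fin d) ℝ} (hM : M.trace = 1) (hg : ∀ x, g x * (g x)ᵀ = M)
    (B : Fin n → Matrix (Fin d) (Fin d) ℝ) : sqNorm (g - linFun ρ B)
      = 1 - ∑ i, frobSq (projCoeff ρ g i) + ∑ i, frobSq (projCoeff ρ g i - B i) := by
  have h1 : 𝔼 x, frobSq (g x) = 1 := by
    simp [← trace_mul_transpose_eq_frobSq, hg, hM]
  rw [← h1, ← hρ.expect_frobSq_sub_linPart hd]
  rfl

theorem theorem7p1 :
    ∃ C : ℝ, 0 < C ∧
      ∀ (m n : ℕ) (ρ : Equiv.Perm (Fin m) → Matrix (Fin (m - 1)) (Fin (m - 1)) ℝ)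
        (g : (Fin n → Equiv.Perm (Fin m)) → Matrix (Fin (m - 1)) (Fin (m - 1)) ℝ)
        (M : Matrix (Fin (m - 1)) (Fin (m - 1)) ℝ) (τ : ℝ),
        IsStandardRep ρ →
        (𝔼 x, g x) = 0 →
        M.trace = 1 →
        (∀ x, g x * (g x)ᵀ = M) →
        sqDist g (Lin n ρ) ≤ τ →
        -- the `A i` are the coefficients of the projection of `g` on `Lin n ρ`
        ∃ A : Fin n → Matrix (Fin (m - 1)) (Fin (m - 1)) ℝ,
          (∀ h ∈ Lin n ρ, sqNorm (g - linFun ρ A) ≤ sqNorm (g - h)) ∧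
          ∃ i : Fin n, sqNorm (fun x => g x - A i * ρ (x i)) ≤ C * ((m : ℝ) ^ 5 * τ) := by
  -- 9216 = (16 · 6)²: 16 from reverse Hölder, 6 from the L¹ bound; the 3 is that of
  -- `exists_one_sub_le`.
  refine ⟨3 * 9216, by norm_num, fun m n ρ g M τ hstd hE hM hg hdist => ?_⟩
  have hm : 2 ≤ m := by
    by_contra hlt
    have : IsEmpty (Fin (m - 1)) := by
      rw [show m - 1 = 0 by omega]; infer_instance
    simp [Matrix.trace] at hM
  have hd : 1 ≤ m - 1 := by omega
  -- For n = 0, g is constant, so mean zero gives g = 0, against tr M = 1.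
  have hn : Nonempty (Fin n) := by
    by_contra hempty
    rw [not_nonempty_iff] at hempty
    have hg0 : g default = 0 := by
      rw [← hE, expect_congr rfl fun x _ => congrArg g (Subsingleton.elim x default),
        Fintype.expect_const]
    have := hg default
    rw [hg0, Matrix.zero_mul] at this
    simp [← this] at hM
  have hρ := hstd.isSchurFamily hm
  set A := projCoeff ρ g with hA
  have hnorm := sqNorm_sub_linFun hρ hd hM hg
  have hmin : sqNorm (g - linFun ρ A) = 1 - ∑ i, frobSq (A i) := by
    rw [hnorm]; simp [hA, frobSq]
  have hle : ∀ h ∈ Lin n ρ, sqNorm (g - linFun ρ A) ≤ sqNorm (g - h) := by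
    rintro _ ⟨B, rfl⟩
    rw [hmin, hnorm B, le_add_iff_nonneg_right]
    exact sum_nonneg fun _ _ => frobSq_nonneg _
  refine ⟨A, hle, ?_⟩
  set t := sqNorm (g - linFun ρ A) with ht
  have htτ : t ≤ τ := by
    have : Nonempty (Lin n ρ) := ⟨⟨_, A, rfl⟩⟩
    exact (le_ciInf fun h : Lin n ρ => hle h.1 h.2).trans hdist
  have ht0 : 0 ≤ t := expect_nonneg_of_nonneg fun x => frobSq_nonneg _
  have hm1 : (1 : ℝ) ≤ m := by exact_mod_cast (by omega : 1 ≤ m)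
  obtain ⟨i, hi⟩ := exists_one_sub_le (a := fun i => frobSq (A i)) (K := 9216 * (m : ℝ) ^ 5)
    (fun i => frobSq_nonneg _) (by nlinarith [one_le_pow₀ hm1 (n := 5)]) ht0
    (by linarith) fun ht1 => by
      have h1 := hρ.expect_sqrt_frobSq_quadPart_le (A := A) hM hg ht1 ht.symm
      have h2 := hρ.expect_frobSq_quadPart_le (A := A) hd univ
      have h3 := hρ.le_expect_frobSq_quadPart (A := A) hd univ
      have hdm : ((m - 1 : ℕ) : ℝ) ≤ m := by exact_mod_cast Nat.sub_le m 1
      have h0 : 0 ≤ 𝔼 x : Fin n → Equiv.Perm (Fin m), √(frobSq (quadPart ρ A univ x)) :=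
        expect_nonneg_of_nonneg fun x => Real.sqrt_nonneg _
      calc _ ≤ _ := h3
        _ ≤ (m : ℝ) * (16 * (m : ℝ) ^ 2 * (6 * √t)) ^ 2 := by
          refine mul_le_mul hdm (h2.trans ?_)
            (expect_nonneg_of_nonneg fun x => frobSq_nonneg _) (by positivity)
          gcongr
        _ = 9216 * (m : ℝ) ^ 5 * √t ^ 2 := by ring
        _ = _ := by rw [Real.sq_sqrt ht0]
  refine ⟨i, ?_⟩
  -- A single term is itself a linear function, so `hnorm` evaluates its distance exactly.
  have hsingle : (fun x => g x - A i * ρ (x i)) = g - linFun ρ (Pi.single i (A i)) := by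
    funext x
    rw [Pi.sub_apply, linFun, sum_eq_single i (fun j _ hj => by simp [hj]) (by simp),
      Pi.single_eq_same]
  have hval : sqNorm (fun x => g x - A i * ρ (x i)) = 1 - frobSq (A i) := by
    have e : ∑ j, frobSq (A j - (Pi.single i (A i) : Fin n → Matrix _ _ ℝ) j)
        = ∑ j, frobSq (A j) - frobSq (A i) := by
      rw [← add_sum_erase _ _ (mem_univ i), ← add_sum_erase univ (fun j => frobSq (A j)) (mem_univ i),
        add_sub_cancel_left, Pi.single_eq_same, sub_self,
        sum_congr rfl fun j hj => by rw [Pi.single_eq_of_ne (ne_of_mem_erase hj), sub_zero]]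
      simp [frobSq]
    rw [hsingle, hnorm, e]
    ring
  rw [hval]
  calc _ ≤ _ := hi
    _ ≤ 3 * (9216 * (m : ℝ) ^ 5) * τ := by gcongr
    _ = _ := by ring

end Main
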